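/- **Conventions.** 2-categories are weak (bicategories), and composition of 1-morphisms is written $\otimes$, from left to right; associators and unitors are suppressed below. A *right dual* of a 1-morphism $X:r\to s$ is a 1-morphism $X^*:s\to r$ with 2-morphisms $\eta:\mathrm{id}_s\to X^*\otimes X$ and $\epsilon:X\otimes X^*\to\mathrm{id}_r$ satisfying the two snake equations; a *left dual* is a 1-morphism ${}^*X:s\to r$ with 2-morphisms $\mathrm{id}_r\to X\otimes{}^*X$ and ${}^*X\otimes X\to\mathrm{id}_s$ satisfying the two snake equations. Let $\mathcal C$ be a 2-category with a chosen right dual for every 1-morphism. A 2-morphism $f:X\to Y$ has a right transpose $f^*:Y^*\to X^*$, and the *double dual pseudofunctor* ${**}:\mathcal C\to\mathcal C$ is the identity on objects, sends $X\mapsto X^{**}$ and $f\mapsto f^{**}$, and has as structure maps $(\mathrm{id}_r)^{**}\cong\mathrm{id}_r$ and $(X\otimes Y)^{**}\cong X^{**}\otimes Y^{**}$ the canonical isomorphisms between duals. A *pivotal structure* on $\mathcal C$ is an invertible icon $\iota:{**}\to\mathrm{id}_{\mathcal C}$ (a pseudonatural transformation whose 1-morphism components are identities), that is, a family of invertible 2-morphisms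 $\iota_X:X^{**}\to X$, natural in $X$ and compatible with the structure maps of ${**}$. A *pivotal 2-category* is a 2-category with chosen right duals and a pivotal structure. In a pivotal 2-category $X^*$ is also the chosen left dual of $X$: use the right duality between $X^*$ and $X^{**}$ and the isomorphism $\iota_X:X^{**}\to X$. Let $\mathcal C,\mathcal D$ be pivotal 2-categories. A pseudofunctor $F:\mathcal C\to\mathcal D$ carries (left, right) duals to (left, right) duals, so that for each 1-morphism $X$ of $\mathcal C$ uniqueness of left duals and of right duals gives two isomorphisms $F_l,F_r:F(X^*)\to F(X)^*$; $F$ is *pivotal* if $F_l=F_r$ for all $X$. Let $\mathrm{Fun}_p(\mathcal C,\mathcal D)$ be the 2-category of pivotal pseudofunctors $\mathcal C\to\mathcal D$, all pseudonatural transformations between them and all modifications between these. It has chosen right duals: the right dual of $\alpha:F\to G$ is the transformation $\alpha^*:G\to F$ with 1-morphism components $(\alpha^*)_r=(\alpha_r)^*$, whose 2-morphism component $G(X)\otimes(\alpha_s)^*\to(\alpha_r)^*\otimes F(X)$ at $X:r\to s$ is the right transpose of the component $\alpha_{{}^*X}:F({}^*X)\otimes\alpha_r\to\alpha_s\otimes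 G({}^*X)$ at the left dual ${}^*X$ of $X$ (using that $F(X)$ and $G(X)$ are right duals of $F({}^*X)$ and $G({}^*X)$); the unit and counit of this duality have as components those of the chosen dualities in $\mathcal D$ for the $\alpha_r$. **Theorem.** Let $\mathcal C$ and $\mathcal D$ be pivotal 2-categories, with $\iota$ the pivotal structure of $\mathcal D$. Then $\mathrm{Fun}_p(\mathcal C,\mathcal D)$, with the right duals above, is a pivotal 2-category. More precisely, for every pseudonatural transformation $\alpha:F\to G$ between pivotal pseudofunctors, the 2-isomorphisms $\iota_{\alpha_r}:(\alpha_r)^{**}\to\alpha_r$, where $r$ runs over the objects of $\mathcal C$, are the components of an invertible modification $\hat\iota_\alpha:\alpha^{**}\to\alpha$, and the family $\hat\iota$ is a pivotal structure on $\mathrm{Fun}_p(\mathcal C,\mathcal D)$, that is, an invertible icon from its double dual pseudofunctor to its identity pseudofunctor. -/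

import Mathlib

open CategoryTheory
open scoped Bicategory Pseudofunctor.StrongTrans

universe w v u w₁ v₁ u₁ w₂ v₂ u₂

namespace CategoryTheory.Bicategory

section Duals
variable {C : Type u} [Bicategory.{w, v} C]

/-- Chosen right duals for all 1-morphisms. Composition `≫` of 1-morphisms is the tensor product
`⊗` read from left to right. Mathlib's `Y ⊣ X`, for `X : r ⟶ s` and `Y : s ⟶ r`, consists of
`η : 𝟙 s ⟶ Y ≫ X` and `ε : X ≫ Y ⟶ 𝟙 r` satisfying the two snake equations. -/
class RightDuals (C : Type u) [Bicategory.{w, v} C] where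
  dual {r s : C} (X : r ⟶ s) : s ⟶ r
  adj {r s : C} (X : r ⟶ s) : dual X ⊣ X

open RightDuals

/-- The transpose of the transpose of `f : X ⟶ Y`, for any choice of the duals: `X₁`, `Y₁` are right
duals of `X`, `Y`, and `X₂`, `Y₂` are right duals of `X₁`, `Y₁`. -/
def doubleMate {r s : C} {X X₂ Y Y₂ : r ⟶ s} {X₁ Y₁ : s ⟶ r}
    (a : X₁ ⊣ X) (a' : X₂ ⊣ X₁) (b : Y₁ ⊣ Y) (b' : Y₂ ⊣ Y₁) (f : X ⟶ Y) : X₂ ⟶ Y₂ :=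
  (conjugateEquiv b' a').symm ((conjugateEquiv a b).symm f)

section
variable {r s t : C} {X Y Z X₂ Y₂ Z₂ : r ⟶ s} {X₁ Y₁ Z₁ : s ⟶ r}
    (a : X₁ ⊣ X) (a' : X₂ ⊣ X₁) (b : Y₁ ⊣ Y) (b' : Y₂ ⊣ Y₁) (c : Z₁ ⊣ Z) (c' : Z₂ ⊣ Z₁)

theorem doubleMate_id : doubleMate a a' a a' (𝟙 X) = 𝟙 X₂ := by
  simp [doubleMate]

theorem doubleMate_comp (f : X ⟶ Y) (g : Y ⟶ Z) :
    doubleMate a a' b b' f ≫ doubleMate b b' c c' g = doubleMate a a' c c' (f ≫ g) := by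
  simp [doubleMate]

/-- `doubleMate` of an invertible 2-morphism. -/
def doubleMateIso (f : X ≅ Y) : X₂ ≅ Y₂ where
  hom := doubleMate a a' b b' f.hom
  inv := doubleMate b b' a a' f.inv
  hom_inv_id := by rw [doubleMate_comp, f.hom_inv_id, doubleMate_id]
  inv_hom_id := by rw [doubleMate_comp, f.inv_hom_id, doubleMate_id]
end

theorem doubleMate_whiskerLeft {r s t : C} {X X₂ : r ⟶ s} {X₁ : s ⟶ r} {Y Z Y₂ Z₂ : s ⟶ t}
    {Y₁ Z₁ : t ⟶ s} (a : X₁ ⊣ X) (a' : X₂ ⊣ X₁) (b : Y₁ ⊣ Y) (b' : Y₂ ⊣ Y₁) (c : Z₁ ⊣ Z)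
    (c' : Z₂ ⊣ Z₁) (f : Y ⟶ Z) :
    doubleMate (b.comp a) (a'.comp b') (c.comp a) (a'.comp c') (X ◁ f) =
      X₂ ◁ doubleMate b b' c c' f := by
  rw [doubleMate, Equiv.symm_apply_eq, conjugateEquiv_whiskerLeft, Equiv.symm_apply_eq,
    conjugateEquiv_whiskerRight]
  simp [doubleMate]

theorem doubleMate_whiskerRight {r s t : C} {X Z X₂ Z₂ : r ⟶ s} {X₁ Z₁ : s ⟶ r} {Y Y₂ : s ⟶ t}
    {Y₁ : t ⟶ s} (a : X₁ ⊣ X) (a' : X₂ ⊣ X₁) (b : Y₁ ⊣ Y) (b' : Y₂ ⊣ Y₁) (c : Z₁ ⊣ Z)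
    (c' : Z₂ ⊣ Z₁) (f : X ⟶ Z) :
    doubleMate (b.comp a) (a'.comp b') (b.comp c) (c'.comp b') (f ▷ Y) =
      doubleMate a a' c c' f ▷ Y₂ := by
  rw [doubleMate, Equiv.symm_apply_eq, conjugateEquiv_whiskerRight, Equiv.symm_apply_eq,
    conjugateEquiv_whiskerLeft]
  simp [doubleMate]

theorem doubleMate_associator {r s t u : C} {X X₂ : r ⟶ s} {X₁ : s ⟶ r} {Y Y₂ : s ⟶ t}
    {Y₁ : t ⟶ s} {Z Z₂ : t ⟶ u} {Z₁ : u ⟶ t} (a : X₁ ⊣ X) (a' : X₂ ⊣ X₁) (b : Y₁ ⊣ Y)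
    (b' : Y₂ ⊣ Y₁) (c : Z₁ ⊣ Z) (c' : Z₂ ⊣ Z₁) :
    doubleMate (c.comp (b.comp a)) ((a'.comp b').comp c') ((c.comp b).comp a)
      (a'.comp (b'.comp c')) (α_ X Y Z).hom = (α_ X₂ Y₂ Z₂).hom := by
  rw [doubleMate, Equiv.symm_apply_eq, conjugateEquiv_associator_hom, Equiv.symm_apply_eq,
    conjugateEquiv_associator_hom]

theorem doubleMate_leftUnitor {r s : C} {X X₂ : r ⟶ s} {X₁ : s ⟶ r}
    (a : X₁ ⊣ X) (a' : X₂ ⊣ X₁) :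
    doubleMate (a.comp (Adjunction.id r)) ((Adjunction.id r).comp a') a a' (λ_ X).hom =
      (λ_ X₂).hom := by
  have h1 := conjugateEquiv_comp_id_right_apply a a (𝟙 X₁)
  have h2 := conjugateEquiv_id_comp_right_apply a' a' (𝟙 X₂)
  rw [conjugateEquiv_id, Category.id_comp, Category.comp_id] at h1 h2
  have h3 : (conjugateEquiv (a.comp (Adjunction.id r)) a).symm (λ_ X).hom = (ρ_ X₁).inv := by
    rw [← cancel_mono (ρ_ X₁).hom, Iso.inv_hom_id,
      ← (conjugateEquiv a (a.comp (Adjunction.id r))).symm_apply_apply (ρ_ X₁).hom, h1,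
      conjugateEquiv_symm_comp, Iso.inv_hom_id, conjugateEquiv_symm_id]
  rw [doubleMate, h3, Equiv.symm_apply_eq, h2]

theorem doubleMate_rightUnitor {r s : C} {X X₂ : r ⟶ s} {X₁ : s ⟶ r}
    (a : X₁ ⊣ X) (a' : X₂ ⊣ X₁) :
    doubleMate ((Adjunction.id s).comp a) (a'.comp (Adjunction.id s)) a a' (ρ_ X).hom =
      (ρ_ X₂).hom := by
  have h1 := conjugateEquiv_id_comp_right_apply a a (𝟙 X₁)
  have h2 := conjugateEquiv_comp_id_right_apply a' a' (𝟙 X₂)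
  rw [conjugateEquiv_id, Category.id_comp, Category.comp_id] at h1 h2
  have h3 : (conjugateEquiv ((Adjunction.id s).comp a) a).symm (ρ_ X).hom = (λ_ X₁).inv := by
    rw [← cancel_mono (λ_ X₁).hom, Iso.inv_hom_id,
      ← (conjugateEquiv a ((Adjunction.id s).comp a)).symm_apply_apply (λ_ X₁).hom, h1,
      conjugateEquiv_symm_comp, Iso.inv_hom_id, conjugateEquiv_symm_id]
  rw [doubleMate, h3, Equiv.symm_apply_eq, h2]

/-- For a transformation with identity 1-morphism components, the composition axiom, written
without the unitors. -/
theorem icon_comp_iff {r s t : C} {X X₂ : r ⟶ s} {Y Y₂ : s ⟶ t} {Z₂ : r ⟶ t}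
    (m : Z₂ ⟶ X₂ ≫ Y₂) (i : X₂ ⟶ X) (j : Y₂ ⟶ Y) (k : Z₂ ⟶ X ≫ Y) :
    ((ρ_ _).hom ≫ k ≫ (λ_ (X ≫ Y)).inv) ≫ 𝟙 r ◁ 𝟙 (X ≫ Y) =
      m ▷ 𝟙 t ≫ (α_ _ _ _).hom ≫
        X₂ ◁ ((ρ_ _).hom ≫ j ≫ (λ_ Y).inv) ≫ (α_ _ _ _).inv ≫
          ((ρ_ _).hom ≫ i ≫ (λ_ X).inv) ▷ Y ≫ (α_ _ _ _).hom ↔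
    k = m ≫ i ▷ Y₂ ≫ X ◁ j := by
  have : m ▷ 𝟙 t ≫ (α_ _ _ _).hom ≫
        X₂ ◁ ((ρ_ _).hom ≫ j ≫ (λ_ Y).inv) ≫ (α_ _ _ _).inv ≫
          ((ρ_ _).hom ≫ i ≫ (λ_ X).inv) ▷ Y ≫ (α_ _ _ _).hom =
      ((ρ_ _).hom ≫ (m ≫ i ▷ Y₂ ≫ X ◁ j) ≫ (λ_ (X ≫ Y)).inv) := by
    simp [← whisker_exchange_assoc]
  rw [this, whiskerLeft_id, Category.comp_id, cancel_epi, cancel_mono]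

/-- For a transformation with identity 1-morphism components, the unit axiom, written without the
unitors. -/
theorem icon_id_iff {r : C} {X₂ : r ⟶ r} (m k : X₂ ⟶ 𝟙 r) :
    ((ρ_ _).hom ≫ k ≫ (λ_ (𝟙 r)).inv) ≫ 𝟙 r ◁ 𝟙 (𝟙 r) =
      m ▷ 𝟙 r ≫ (λ_ (𝟙 r)).hom ≫ (ρ_ (𝟙 r)).inv ↔ k = m := by
  rw [unitors_equal, unitors_inv_equal]
  simp

variable [RightDuals C]

/-- The right transpose `f* : Y* ⟶ X*` of a 2-morphism `f : X ⟶ Y`, obtained by bending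
`f` with the unit for `X` and the counit for `Y`. -/
def transpose {r s : C} {X Y : r ⟶ s} (f : X ⟶ Y) : dual Y ⟶ dual X :=
  (conjugateEquiv (adj X) (adj Y)).symm f

theorem transpose_transpose {r s : C} {X Y : r ⟶ s} (f : X ⟶ Y) :
    transpose (transpose f) = doubleMate (adj X) (adj (dual X)) (adj Y) (adj (dual Y)) f := rfl

/-- The double right dual pseudofunctor `**`: the identity on objects, `X ↦ X**` on 1-morphisms and
`f ↦ f**` on 2-morphisms. Its unitor `(𝟙 r)** ≅ 𝟙 r` and multiplicator
`(X ≫ Y)** ≅ X** ≫ Y**` are the canonical isomorphisms between two right duals of (canonically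
identified) right duals. -/
@[simps]
def doubleDual (C : Type u) [Bicategory.{w, v} C] [RightDuals C] : C ⥤ᵖ C where
  obj r := r
  map X := dual (dual X)
  map₂ f := transpose (transpose f)
  map₂_id X := by simp [transpose]
  map₂_comp f g := by simp [transpose]
  mapId r := doubleMateIso (adj _) (adj _) (Adjunction.id r) (Adjunction.id r) (Iso.refl _)
  mapComp X Y := doubleMateIso (adj _) (adj _) ((adj Y).comp (adj X))
    ((adj (dual X)).comp (adj (dual Y))) (Iso.refl _)
  map₂_whisker_left X Y Z f := by
    simp only [doubleMateIso, transpose_transpose]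
    rw [← doubleMate_whiskerLeft (adj X) (adj (dual X)), doubleMate_comp, doubleMate_comp]
    simp
  map₂_whisker_right f Z := by
    simp only [doubleMateIso, transpose_transpose]
    rw [← doubleMate_whiskerRight _ _ (adj Z) (adj (dual Z)), doubleMate_comp, doubleMate_comp]
    simp
  map₂_associator X Y Z := by
    simp only [doubleMateIso, transpose_transpose]
    rw [← doubleMate_associator (adj X) (adj (dual X)) (adj Y) (adj (dual Y)) (adj Z)
        (adj (dual Z)),
      ← doubleMate_whiskerLeft (adj X) (adj (dual X)),
      ← doubleMate_whiskerRight _ _ (adj Z) (adj (dual Z)), doubleMate_comp, doubleMate_comp,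
      doubleMate_comp, doubleMate_comp]
    simp
  map₂_left_unitor X := by
    simp only [doubleMateIso, transpose_transpose]
    rw [← doubleMate_leftUnitor (adj X) (adj (dual X)),
      ← doubleMate_whiskerRight _ _ (adj X) (adj (dual X)), doubleMate_comp, doubleMate_comp]
    simp
  map₂_right_unitor X := by
    simp only [doubleMateIso, transpose_transpose]
    rw [← doubleMate_rightUnitor (adj X) (adj (dual X)),
      ← doubleMate_whiskerLeft (adj X) (adj (dual X)), doubleMate_comp, doubleMate_comp]
    simp

/-- A pivotal structure: an invertible icon `ι` from the double right dual pseudofunctor to the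
identity pseudofunctor. Since both are the identity on objects, an icon amounts to 2-morphisms
`X** ⟶ X` that are natural, and compatible with the unitors and the multiplicators; see
`PivotalStructure.toStrongTrans` and `PivotalStructure.exists_toStrongTrans_eq`. -/
class PivotalStructure (C : Type u) [Bicategory.{w, v} C] [RightDuals C] where
  ι {r s : C} (X : r ⟶ s) : dual (dual X) ≅ X
  ι_naturality {r s : C} {X Y : r ⟶ s} (f : X ⟶ Y) :
    transpose (transpose f) ≫ (ι Y).hom = (ι X).hom ≫ f
  ι_id (r : C) : (ι (𝟙 r)).hom = ((doubleDual C).mapId r).hom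
  ι_comp {r s t : C} (X : r ⟶ s) (Y : s ⟶ t) :
    (ι (X ≫ Y)).hom = ((doubleDual C).mapComp X Y).hom ≫
      (ι X).hom ▷ dual (dual Y) ≫ X ◁ (ι Y).hom

namespace PivotalStructure

/-- A pivotal structure, as a pseudonatural transformation with identity 1-morphism components. -/
def toStrongTrans (C : Type u) [Bicategory.{w, v} C] [RightDuals C] [PivotalStructure C] :
    doubleDual C ⟶ Pseudofunctor.id C where
  app r := 𝟙 r
  naturality {r s} X := (ρ_ (dual (dual X)) ≪≫ ι X ≪≫ (λ_ X).symm : dual (dual X) ≫ 𝟙 s ≅ 𝟙 r ≫ X)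
  naturality_naturality {r s X Y} f := by
    change transpose (transpose f) ▷ 𝟙 s ≫ ((ρ_ _).hom ≫ (ι Y).hom ≫ (λ_ Y).inv) =
      ((ρ_ _).hom ≫ (ι X).hom ≫ (λ_ X).inv) ≫ 𝟙 r ◁ f
    simp [reassoc_of% (ι_naturality f)]
  naturality_id r := (icon_id_iff ((doubleDual C).mapId r).hom _).2 (ι_id r)
  naturality_comp X Y :=
    (icon_comp_iff ((doubleDual C).mapComp X Y).hom (ι X).hom (ι Y).hom _).2 (ι_comp X Y)

/-- Every pseudonatural transformation `** ⟶ id` with identity 1-morphism components is given by a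
pivotal structure. -/
theorem exists_toStrongTrans_eq (τ : doubleDual C ⟶ Pseudofunctor.id C)
    (h : ∀ r, τ.app r = 𝟙 r) : ∃ P : PivotalStructure C, @toStrongTrans C _ _ P = τ := by
  obtain ⟨app, nat, h1, h2, h3⟩ := τ
  obtain rfl : app = fun r => 𝟙 r := funext h
  obtain ⟨j, rfl⟩ : ∃ j : ∀ {r s : C} (X : r ⟶ s), dual (dual X) ≅ X,
      @nat = fun {r s} X =>
        (ρ_ (dual (dual X)) ≪≫ j X ≪≫ (λ_ X).symm : dual (dual X) ≫ 𝟙 s ≅ 𝟙 r ≫ X) :=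
    ⟨fun {r s} X => ((ρ_ (dual (dual X))).symm ≪≫ nat X ≪≫ λ_ X : dual (dual X) ≅ X), by
      funext r s X
      have aux {W : r ⟶ s} (n : W ≫ 𝟙 s ≅ 𝟙 r ≫ X) :
          n = ρ_ W ≪≫ ((ρ_ W).symm ≪≫ n ≪≫ λ_ X) ≪≫ (λ_ X).symm := by ext; simp
      exact aux (nat X)⟩
  exact ⟨{
    ι X := j X
    ι_naturality {r s X Y} f := by
      have := h1 f
      change transpose (transpose f) ▷ 𝟙 s ≫ ((ρ_ _).hom ≫ (j Y).hom ≫ (λ_ Y).inv) =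
        ((ρ_ _).hom ≫ (j X).hom ≫ (λ_ X).inv) ≫ 𝟙 r ◁ f at this
      simpa [← reassoc_of% this] using this
    ι_id r := (icon_id_iff ((doubleDual C).mapId r).hom _).1 (h2 r)
    ι_comp {r s t} X Y := (icon_comp_iff ((doubleDual C).mapComp X Y).hom _ _ _).1 (h3 X Y) }, rfl⟩

end PivotalStructure

end Duals

section Trans
variable {D : Type u} [Bicategory.{w, v} D]

/-- Transport of an adjunction along an isomorphism of the left-hand 1-morphism. -/
@[simps]
def adjunctionOfIso {r s : D} {X X' : r ⟶ s} {Y : s ⟶ r} (a : X ⊣ Y) (e : X ≅ X') : X' ⊣ Y where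
  unit := a.unit ≫ e.hom ▷ Y
  counit := Y ◁ e.inv ≫ a.counit
  left_triangle := by
    calc
      _ = 𝟙 _ ⊗≫ a.unit ▷ X' ⊗≫ (e.hom ▷ (Y ≫ X') ≫ X' ◁ Y ◁ e.inv) ⊗≫ X' ◁ a.counit ⊗≫ 𝟙 _ := by
        dsimp only [leftZigzag]; bicategory
      _ = 𝟙 _ ⊗≫ (a.unit ▷ X' ≫ (X ≫ Y) ◁ e.inv) ⊗≫ (e.hom ▷ (Y ≫ X) ≫ X' ◁ a.counit) ⊗≫ 𝟙 _ := by
        rw [← whisker_exchange]; bicategory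
      _ = 𝟙 _ ⊗≫ e.inv ⊗≫ leftZigzag a.unit a.counit ⊗≫ e.hom ⊗≫ 𝟙 _ := by
        rw [← whisker_exchange, ← whisker_exchange]; bicategory
      _ = 𝟙 _ ⊗≫ (e.inv ≫ e.hom) ⊗≫ 𝟙 _ := by
        rw [a.left_triangle]; bicategory
      _ = _ := by rw [e.inv_hom_id]; bicategory
  right_triangle := by
    calc
      _ = 𝟙 _ ⊗≫ Y ◁ a.unit ⊗≫ Y ◁ (e.hom ≫ e.inv) ▷ Y ⊗≫ a.counit ▷ Y ⊗≫ 𝟙 _ := by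
        dsimp only [rightZigzag]; bicategory
      _ = rightZigzag a.unit a.counit := by rw [e.hom_inv_id]; bicategory
      _ = _ := a.right_triangle

section
variable {c d e f : D} {g : c ⟶ e} {h : d ⟶ f} {l₁ : c ⟶ d} {r₁ : d ⟶ c} {l₂ : e ⟶ f} {r₂ : f ⟶ e}
variable (adj₁ : l₁ ⊣ r₁) (adj₂ : l₂ ⊣ r₂)

theorem leftZigzag_eq (η : 𝟙 c ⟶ l₁ ≫ r₁) (θ : r₁ ≫ l₁ ⟶ 𝟙 d) :
    leftZigzag η θ = η ▷ l₁ ≫ (α_ _ _ _).hom ≫ l₁ ◁ θ := by bicategory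

theorem rightZigzag_eq (η : 𝟙 c ⟶ l₁ ≫ r₁) (θ : r₁ ≫ l₁ ⟶ 𝟙 d) :
    rightZigzag η θ = r₁ ◁ η ≫ (α_ _ _ _).inv ≫ θ ▷ r₁ := by bicategory

theorem mate_symm_natural {g' : c ⟶ e} {h' : d ⟶ f} (u : g' ⟶ g) (b : r₁ ≫ g ⟶ h ≫ r₂)
    (v : h ⟶ h') :
    (mateEquiv adj₁ adj₂).symm (r₁ ◁ u ≫ b ≫ v ▷ r₂) =
      u ▷ l₂ ≫ (mateEquiv adj₁ adj₂).symm b ≫ l₁ ◁ v := by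
  simp only [mateEquiv_symm_apply']
  calc
    _ = 𝟙 _ ⊗≫ (adj₁.unit ▷ g' ≫ (l₁ ≫ r₁) ◁ u) ▷ l₂ ⊗≫ l₁ ◁ b ▷ l₂ ⊗≫
          l₁ ◁ (v ▷ (r₂ ≫ l₂) ≫ h' ◁ adj₂.counit) ⊗≫ 𝟙 _ := by
      bicategory
    _ = _ := by
      rw [← whisker_exchange, ← whisker_exchange]; bicategory

theorem mate_unit (N : g ≫ l₂ ⟶ l₁ ≫ h) (b : r₁ ≫ g ⟶ h ≫ r₂)
    (hN : N = (mateEquiv adj₁ adj₂).symm b) :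
    g ◁ adj₂.unit ≫ (α_ _ _ _).inv ≫ N ▷ r₂ ≫ (α_ _ _ _).hom =
      (ρ_ _).hom ≫ (λ_ _).inv ≫ adj₁.unit ▷ g ≫ (α_ _ _ _).hom ≫ l₁ ◁ b := by
  have := (mateEquiv_eq_iff adj₁ adj₂ N b).1 (by rw [hN, Equiv.apply_symm_apply])
  simp only [Adjunction.homEquiv₁_symm_apply, Adjunction.homEquiv₂_apply, Category.assoc] at this
  rw [this, Iso.hom_inv_id_assoc]

theorem mate_counit (N : g ≫ l₂ ⟶ l₁ ≫ h) (b : r₁ ≫ g ⟶ h ≫ r₂)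
    (hN : N = (mateEquiv adj₁ adj₂).symm b) :
    r₁ ◁ N ≫ (α_ _ _ _).inv ≫ adj₁.counit ▷ h =
      (α_ _ _ _).inv ≫ b ▷ l₂ ≫ (α_ _ _ _).hom ≫ h ◁ adj₂.counit ≫ (ρ_ _).hom ≫ (λ_ _).inv := by
  subst hN
  rw [← cancel_mono (λ_ _).hom]
  have := adj₁.homEquiv₁_apply ((mateEquiv adj₁ adj₂).symm b)
  rw [Category.assoc, Category.assoc, ← this]
  rw [mateEquiv_symm_apply, ← Equiv.eq_symm_apply]
  simp [Adjunction.homEquiv₂_symm_apply, Adjunction.homEquiv₁_symm_apply]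
end

end Trans

/-- Chosen left duals for all 1-morphisms: for `X : r ⟶ s` a 1-morphism `*X : s ⟶ r` with
`𝟙 r ⟶ X ≫ *X` and `*X ≫ X ⟶ 𝟙 s` satisfying the two snake equations. -/
class LeftDuals (C : Type u) [Bicategory.{w, v} C] where
  leftDual {r s : C} (X : r ⟶ s) : s ⟶ r
  leftAdj {r s : C} (X : r ⟶ s) : X ⊣ leftDual X

open LeftDuals RightDuals

section Fun
variable {C : Type u₁} [Bicategory.{w₁, v₁} C] {D : Type u₂} [Bicategory.{w₂, v₂} D]

section
variable {F G : C ⥤ᵖ D} (τ : F ⟶ G)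

theorem trans_unit {a b : C} {f : a ⟶ b} {g : b ⟶ a} (η : 𝟙 a ⟶ f ≫ g) :
    ((F.mapId a).inv ≫ F.map₂ η ≫ (F.mapComp f g).hom) ▷ τ.app a ≫ (α_ _ _ _).hom ≫
      F.map f ◁ (τ.naturality g).hom ≫ (α_ _ _ _).inv ≫ (τ.naturality f).hom ▷ G.map g ≫
        (α_ _ _ _).hom =
      (λ_ _).hom ≫ (ρ_ _).inv ≫ τ.app a ◁ ((G.mapId a).inv ≫ G.map₂ η ≫ (G.mapComp f g).hom) := by
  have h1 := τ.naturality_comp f g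
  have h2 := τ.naturality_naturality η
  simp only [comp_whiskerRight, Category.assoc, whiskerLeft_comp]
  rw [← h1, reassoc_of% h2, Pseudofunctor.StrongTrans.naturality_id_hom]
  simp

theorem mate_naturality {r s : C} {X : r ⟶ s} {Y : s ⟶ r} (a : X ⊣ Y) :
    (mateEquiv (F.mapAdjunction a) (G.mapAdjunction a)).symm (τ.naturality Y).hom =
      (τ.naturality X).inv := by
  have h := trans_unit τ a.unit
  have h' : (F.mapAdjunction a).unit ▷ τ.app r ⊗≫ F.map X ◁ (τ.naturality Y).hom ⊗≫
      (τ.naturality X).hom ▷ G.map Y = 𝟙 _ ⊗≫ τ.app r ◁ (G.mapAdjunction a).unit ⊗≫ 𝟙 _ := by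
    rw [← cancel_mono (α_ _ _ _).hom]
    trans (F.mapAdjunction a).unit ▷ τ.app r ≫ (α_ _ _ _).hom ≫
      F.map X ◁ (τ.naturality Y).hom ≫ (α_ _ _ _).inv ≫ (τ.naturality X).hom ▷ G.map Y ≫
        (α_ _ _ _).hom
    · bicategory
    · exact h.trans (by simp [bicategoricalComp])
  rw [← cancel_mono (τ.naturality X).hom, Iso.inv_hom_id, mateEquiv_symm_apply']
  calc
    _ = 𝟙 _ ⊗≫ (F.mapAdjunction a).unit ▷ τ.app r ▷ G.map X ⊗≫
          F.map X ◁ (τ.naturality Y).hom ▷ G.map X ⊗≫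
          ((F.map X ≫ τ.app s) ◁ (G.mapAdjunction a).counit ≫ (τ.naturality X).hom ▷ 𝟙 _) ⊗≫ 𝟙 _ := by
      bicategory
    _ = 𝟙 _ ⊗≫ ((F.mapAdjunction a).unit ▷ τ.app r ⊗≫ F.map X ◁ (τ.naturality Y).hom ⊗≫
          (τ.naturality X).hom ▷ G.map Y) ▷ G.map X ⊗≫
          τ.app r ◁ G.map X ◁ (G.mapAdjunction a).counit ⊗≫ 𝟙 _ := by
      rw [whisker_exchange]; bicategory
    _ = 𝟙 _ ⊗≫ τ.app r ◁ leftZigzag (G.mapAdjunction a).unit (G.mapAdjunction a).counit ⊗≫ 𝟙 _ := by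
      rw [h']; bicategory
    _ = _ := by
      rw [(G.mapAdjunction a).left_triangle]; bicategory

variable [LeftDuals C] [RightDuals D]

/-- The 2-morphism component at `X` of the right dual of `τ : F ⟶ G`: the right transpose of the
component `F(*X) ≫ τ_r ≅ τ_s ≫ G(*X)` of `τ` at the left dual `*X`. The target of this component
has the right dual `G(X) ≫ (τ_s)*`, its source has the right dual `(τ_r)* ≫ F(X)`; here `G(X)` is
a right dual of `G(*X)`, because pseudofunctors preserve duals. -/
def dualNaturality {r s : C} (X : r ⟶ s) :
    G.map X ≫ dual (τ.app s) ≅ dual (τ.app r) ≫ F.map X :=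
  (conjugateIsoEquiv ((adj (τ.app r)).comp (F.mapAdjunction (leftAdj X)))
    ((G.mapAdjunction (leftAdj X)).comp (adj (τ.app s)))).symm (τ.naturality (leftDual X))

theorem dualNaturality_hom {r s : C} (X : r ⟶ s) :
    (dualNaturality τ X).hom =
      (mateEquiv (adj (τ.app r)) (adj (τ.app s))).symm (τ.naturality X).inv := by
  rw [dualNaturality, conjugateIsoEquiv_symm_apply_hom,
    ← iterated_mateEquiv_conjugateEquiv_symm, mate_naturality]

/-- The right dual `τ* : G ⟶ F` of a pseudonatural transformation `τ : F ⟶ G`, with 1-morphism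
components `(τ_r)*`. -/
def dualTrans : G ⟶ F where
  app r := dual (τ.app r)
  naturality X := dualNaturality τ X
  naturality_naturality {r s X Y} f := by
    have h := τ.naturality_naturality f
    have h' : τ.app r ◁ G.map₂ f ≫ (τ.naturality Y).inv ≫ 𝟙 (F.map Y) ▷ τ.app s =
        τ.app r ◁ 𝟙 (G.map X) ≫ (τ.naturality X).inv ≫ F.map₂ f ▷ τ.app s := by
      rw [id_whiskerRight, Category.comp_id, whiskerLeft_id, Category.id_comp, Iso.eq_inv_comp,
        ← Category.assoc, ← h, Category.assoc, Iso.hom_inv_id, Category.comp_id]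
    have := congrArg (mateEquiv (adj (τ.app r)) (adj (τ.app s))).symm h'
    rw [mate_symm_natural, mate_symm_natural, id_whiskerRight, whiskerLeft_id, Category.comp_id,
      Category.id_comp] at this
    rw [dualNaturality_hom, dualNaturality_hom, this]
  naturality_id r := by
    have h := congrArg (mateEquiv (adj (τ.app r)) (adj (τ.app r))).symm
      (Pseudofunctor.StrongTrans.naturality_id_inv τ r)
    have h' := mateEquiv_leftUnitor_hom_rightUnitor_inv (adj (τ.app r))
    rw [← Equiv.eq_symm_apply] at h'
    rw [← Category.assoc (ρ_ _).hom, mate_symm_natural, ← h'] at h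
    rw [dualNaturality_hom, h]
    simp
  naturality_comp {r s t} X Y := by
    have h := mateEquiv_vcomp (adj (τ.app r)) (adj (τ.app s)) (adj (τ.app t))
       ((mateEquiv (adj (τ.app r)) (adj (τ.app s))).symm (τ.naturality X).inv)
       ((mateEquiv (adj (τ.app s)) (adj (τ.app t))).symm (τ.naturality Y).inv)
    rw [Equiv.apply_symm_apply, Equiv.apply_symm_apply, ← Equiv.eq_symm_apply] at h
    have h2 : (τ.naturality (X ≫ Y)).inv = τ.app r ◁ (G.mapComp X Y).hom ≫
        rightAdjointSquare.vcomp (τ.naturality X).inv (τ.naturality Y).inv ≫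
          (F.mapComp X Y).inv ▷ τ.app t := by
      rw [Pseudofunctor.StrongTrans.naturality_comp_inv, rightAdjointSquare.vcomp]
      simp only [Category.assoc]
    rw [dualNaturality_hom, h2, mate_symm_natural, ← h, leftAdjointSquare.vcomp,
      ← dualNaturality_hom, ← dualNaturality_hom]
    simp

/-- The unit modification, with components the units for `τ_r`. -/
def dualUnit : 𝟙 G ⟶ dualTrans τ ≫ τ where
  as := {
    app r := (adj (τ.app r)).unit
    naturality {r s} X := by
      have := mate_unit _ _ _ _ (dualNaturality_hom τ X)
      change G.map X ◁ (adj (τ.app s)).unit ≫ ((α_ _ _ _).inv ≫ (dualNaturality τ X).hom ▷ τ.app s ≫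
        (α_ _ _ _).hom ≫ dual (τ.app r) ◁ (τ.naturality X).hom ≫ (α_ _ _ _).inv) =
          ((ρ_ _).hom ≫ (λ_ _).inv) ≫ (adj (τ.app r)).unit ▷ G.map X
      rw [reassoc_of% this]
      simp }

/-- The counit modification, with components the counits for `τ_r`. -/
def dualCounit : τ ≫ dualTrans τ ⟶ 𝟙 F where
  as := {
    app r := (adj (τ.app r)).counit
    naturality {r s} X := by
      have := mate_counit _ _ _ _ (dualNaturality_hom τ X)
      change F.map X ◁ (adj (τ.app s)).counit ≫ ((ρ_ _).hom ≫ (λ_ _).inv) =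
        ((α_ _ _ _).inv ≫ (τ.naturality X).hom ▷ dual (τ.app s) ≫
        (α_ _ _ _).hom ≫ τ.app r ◁ (dualNaturality τ X).hom ≫ (α_ _ _ _).inv) ≫
          (adj (τ.app r)).counit ▷ F.map X
      simp only [Category.assoc, this]
      simp }

/-- `dualTrans τ` is a right dual of `τ`. -/
def dualAdj : dualTrans τ ⊣ τ where
  unit := dualUnit τ
  counit := dualCounit τ
  left_triangle := by
    rw [leftZigzag_eq]
    ext r
    exact (leftZigzag_eq _ _).symm.trans (adj (τ.app r)).left_triangle
  right_triangle := by
    rw [rightZigzag_eq]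
    ext r
    exact (rightZigzag_eq _ _).symm.trans (adj (τ.app r)).right_triangle

/-- The chosen right duals in the bicategory of pseudofunctors `C ⥤ᵖ D`, pseudonatural
transformations and modifications. -/
instance rightDualsPseudofunctor : RightDuals (C ⥤ᵖ D) where
  dual τ := dualTrans τ
  adj τ := dualAdj τ

end
end Fun

section Induced
variable {B : Type*} {C : Type*} [Bicategory C] (F : B → C) [RightDuals C]

/-- A sub-bicategory full on 1-morphisms and 2-morphisms inherits the chosen right duals. -/
instance rightDualsInduced : RightDuals (InducedBicategory C F) where
  dual X := InducedBicategory.mkHom (dual X.hom)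
  adj X :=
    { unit := ⟨(adj X.hom).unit⟩
      counit := ⟨(adj X.hom).counit⟩
      left_triangle := by
        rw [leftZigzag_eq]
        ext
        exact (leftZigzag_eq _ _).symm.trans (adj X.hom).left_triangle
      right_triangle := by
        rw [rightZigzag_eq]
        ext
        exact (rightZigzag_eq _ _).symm.trans (adj X.hom).right_triangle }
end Induced

section Piv
variable {C : Type u₁} [Bicategory.{w₁, v₁} C] {D : Type u₂} [Bicategory.{w₂, v₂} D]
open PivotalStructure

/-- In a pivotal bicategory the chosen right dual `X*` is also the chosen left dual of `X`, through
the right duality between `X*` and `X**` and the isomorphism `ι_X : X** ≅ X`. -/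
instance leftDualsOfPivotal [RightDuals C] [PivotalStructure C] : LeftDuals C where
  leftDual X := dual X
  leftAdj X := adjunctionOfIso (adj (dual X)) (ι X)

variable [RightDuals C] [PivotalStructure C] [RightDuals D] [PivotalStructure D]

/-- The canonical isomorphism `F(X*) ≅ F(X)*` between two right duals of `F(X)`, the first one being
the image of the chosen right duality of `X`. -/
def rightComparison (F : C ⥤ᵖ D) {r s : C} (X : r ⟶ s) : F.map (dual X) ≅ dual (F.map X) :=
  (conjugateIsoEquiv (adj (F.map X)) (F.mapAdjunction (adj X))).symm (Iso.refl _)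

/-- The canonical isomorphism `F(X*) ≅ F(X)*` between two left duals of `F(X)`, the first one being
the image of the chosen left duality of `X` (recall that `X*` is also the left dual of `X`). -/
def leftComparison (F : C ⥤ᵖ D) {r s : C} (X : r ⟶ s) : F.map (dual X) ≅ dual (F.map X) :=
  conjugateIsoEquiv (F.mapAdjunction (leftAdj X)) (leftAdj (F.map X)) (Iso.refl _)

/-- A pseudofunctor between pivotal bicategories is pivotal if the two canonical isomorphisms
`F(X*) ≅ F(X)*` agree for all `X`. -/
def IsPivotal (F : C ⥤ᵖ D) : Prop :=
  ∀ {r s : C} (X : r ⟶ s), leftComparison F X = rightComparison F X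

/-- The bicategory of pivotal pseudofunctors, all pseudonatural transformations between them and all
modifications, with the chosen right duals of `C ⥤ᵖ D`. -/
abbrev PivotalFun (C : Type u₁) [Bicategory.{w₁, v₁} C] (D : Type u₂) [Bicategory.{w₂, v₂} D]
    [RightDuals C] [PivotalStructure C] [RightDuals D] [PivotalStructure D] :=
  InducedBicategory (C ⥤ᵖ D) (Subtype.val : {F : C ⥤ᵖ D // IsPivotal F} → C ⥤ᵖ D)

end Piv
end CategoryTheory.Bicategory

/-!
In a pivotal bicategory the isomorphism `ι_X : X** ≅ X` makes sense for any choice of a right dual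
of a right dual of `X`, not only for the chosen one: transport it along the canonical comparison
(`pivot`). In this form a pivotal structure is natural with respect to double transposes computed
with arbitrary duals (`doubleMate_pivot`) and multiplicative for composed duals (`pivot_comp`),
and if a pseudofunctor `F` is pivotal, then `F(X)` is a right dual of a right dual of itself, through
`F(X*)` and the images of the right and left dualities of `X`, and the isomorphism attached to this
choice of duals is the identity (`IsPivotal.pivot_map`).

For a transformation `τ : F ⟶ G`, the component at `X` of `τ**` is the double transpose of the
component of `τ` at `X`, computed with the images of the dualities of `X` under `F` and `G` and
the chosen dualities of `τ_r` and `τ_s` (`dualNaturality_dualTrans_hom`). Naturality of `pivot`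
applied to the component of `τ` is therefore the modification axiom for `ι_{τ_r}`, because the
factors at `F(X)` and `G(X)` are identities. The axioms of a pivotal structure hold for the family
of these modifications because evaluation at an object `r` carries adjunctions and double
transposes in the bicategory of pivotal pseudofunctors to those in the target (`evalAdj`,
`doubleMate_evalAdj`).
-/

namespace CategoryTheory.Bicategory
open RightDuals LeftDuals PivotalStructure

/-! ### The pivotal isomorphism for arbitrary duals -/

section Pivot
variable {C : Type u} [Bicategory.{w, v} C] [RightDuals C] [PivotalStructure C]

/-- The pivotal isomorphism `X₂ ≅ X` for an arbitrary right dual `X₁` of `X` and an arbitrary right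
dual `X₂` of `X₁`: the canonical isomorphism `X₂ ≅ X**` followed by `ι_X`. -/
def pivot {r s : C} {X X₂ : r ⟶ s} {X₁ : s ⟶ r} (a : X₁ ⊣ X) (a' : X₂ ⊣ X₁) : X₂ ≅ X :=
  doubleMateIso a a' (adj X) (adj (dual X)) (Iso.refl X) ≪≫ ι X

theorem pivot_hom {r s : C} {X X₂ : r ⟶ s} {X₁ : s ⟶ r} (a : X₁ ⊣ X) (a' : X₂ ⊣ X₁) :
    (pivot a a').hom = doubleMate a a' (adj X) (adj (dual X)) (𝟙 X) ≫ (ι X).hom := rfl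

theorem pivot_adj {r s : C} (X : r ⟶ s) : pivot (adj X) (adj (dual X)) = ι X := by
  ext
  rw [pivot_hom, doubleMate_id, Category.id_comp]

theorem doubleMate_pivot {r s : C} {X X₂ Y Y₂ : r ⟶ s} {X₁ Y₁ : s ⟶ r}
    (a : X₁ ⊣ X) (a' : X₂ ⊣ X₁) (b : Y₁ ⊣ Y) (b' : Y₂ ⊣ Y₁) (f : X ⟶ Y) :
    doubleMate a a' b b' f ≫ (pivot b b').hom = (pivot a a').hom ≫ f := by
  rw [pivot_hom, pivot_hom, ← Category.assoc, doubleMate_comp, Category.assoc, ← ι_naturality,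
    transpose_transpose, ← Category.assoc, doubleMate_comp, Category.comp_id, Category.id_comp]

theorem pivot_comp {r s t : C} {X X₂ : r ⟶ s} {X₁ : s ⟶ r} {Y Y₂ : s ⟶ t} {Y₁ : t ⟶ s}
    (a : X₁ ⊣ X) (a' : X₂ ⊣ X₁) (b : Y₁ ⊣ Y) (b' : Y₂ ⊣ Y₁) :
    (pivot (b.comp a) (a'.comp b')).hom = (pivot a a').hom ▷ Y₂ ≫ X ◁ (pivot b b').hom := by
  have h : (ι (X ≫ Y)).hom = doubleMate (adj (X ≫ Y)) (adj (dual (X ≫ Y)))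
      ((adj Y).comp (adj X)) ((adj (dual X)).comp (adj (dual Y))) (𝟙 (X ≫ Y)) ≫
        (ι X).hom ▷ dual (dual Y) ≫ X ◁ (ι Y).hom := ι_comp X Y
  -- The comparison of the composed duals is the horizontal composite of the two comparisons.
  have h' : doubleMate (b.comp a) (a'.comp b') ((adj Y).comp (adj X))
      ((adj (dual X)).comp (adj (dual Y))) (𝟙 (X ≫ Y)) =
        doubleMate a a' (adj X) (adj (dual X)) (𝟙 X) ▷ Y₂ ≫
          dual (dual X) ◁ doubleMate b b' (adj Y) (adj (dual Y)) (𝟙 Y) := by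
    rw [← doubleMate_whiskerRight a a' b b', ← doubleMate_whiskerLeft (adj X) (adj (dual X)),
      doubleMate_comp, id_whiskerRight, whiskerLeft_id, Category.comp_id]
  rw [pivot_hom, h, ← Category.assoc, doubleMate_comp, Category.comp_id, h', pivot_hom,
    pivot_hom]
  simp only [comp_whiskerRight, whiskerLeft_comp, Category.assoc]
  rw [whisker_exchange_assoc]

end Pivot

/-! ### Pivotal pseudofunctors -/

section PivotMap

/-- The canonical isomorphism `X' ≅ X` between a left adjoint of `Y` and its transport along
`e : X ≅ X'` is the inverse of `e`. -/
theorem conjugateEquiv_adjunctionOfIso {C : Type u} [Bicategory.{w, v} C] {r s : C}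
    {X X' : r ⟶ s} {Y : s ⟶ r} (a : X ⊣ Y) (e : X ≅ X') :
    conjugateEquiv a (adjunctionOfIso a e) e.inv = 𝟙 Y := by
  rw [conjugateEquiv_apply', adjunctionOfIso_unit]
  calc
    _ = (ρ_ _).inv ≫ Y ◁ a.unit ≫ Y ◁ (e.hom ≫ e.inv) ▷ Y ≫ (α_ _ _ _).inv ≫
          a.counit ▷ Y ≫ (λ_ _).hom := by simp
    _ = conjugateEquiv a a (𝟙 X) := by
      rw [e.hom_inv_id, conjugateEquiv_apply']
    _ = _ := conjugateEquiv_id a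

variable {C : Type u₁} [Bicategory.{w₁, v₁} C] {D : Type u₂} [Bicategory.{w₂, v₂} D]
variable [RightDuals C] [PivotalStructure C] [RightDuals D] [PivotalStructure D]

/-- A pivotal pseudofunctor carries the left and right duality of `X` to dualities of `F(X)` for
which the pivotal isomorphism is the identity. -/
theorem IsPivotal.pivot_map {F : C ⥤ᵖ D} (hF : IsPivotal F) {r s : C} (X : r ⟶ s) :
    (pivot (F.mapAdjunction (adj X)) (F.mapAdjunction (leftAdj X))).hom = 𝟙 (F.map X) := by
  have hR : (conjugateEquiv (F.mapAdjunction (adj X)) (adj (F.map X))).symm (𝟙 (F.map X)) =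
      conjugateEquiv (adjunctionOfIso (adj (dual (F.map X))) (ι (F.map X)))
        (F.mapAdjunction (leftAdj X)) (𝟙 (F.map X)) :=
    (congrArg Iso.inv (hF X)).symm
  have h : doubleMate (F.mapAdjunction (adj X)) (F.mapAdjunction (leftAdj X)) (adj (F.map X))
      (adj (dual (F.map X))) (𝟙 (F.map X)) = (ι (F.map X)).inv := by
    rw [doubleMate, Equiv.symm_apply_eq, hR]
    -- The chosen left duality of `F(X)` is the right duality of `F(X)*` transported along `ι`.
    have h' := conjugateEquiv_comp (adj (dual (F.map X)))
      (adjunctionOfIso (adj (dual (F.map X))) (ι (F.map X))) (F.mapAdjunction (leftAdj X))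
      (ι (F.map X)).inv (𝟙 (F.map X))
    rw [conjugateEquiv_adjunctionOfIso, Category.id_comp, Category.id_comp] at h'
    exact h'
  rw [pivot_hom, h, Iso.inv_hom_id]

end PivotMap

/-! ### The double dual of a transformation -/

section DoubleDual
variable {C : Type u₁} [Bicategory.{w₁, v₁} C] {D : Type u₂} [Bicategory.{w₂, v₂} D]

/-- The component of `τ*` at `X` may be computed with any left dual `Y` of `X`. -/
theorem dualNaturality_hom_eq_conjugate [LeftDuals C] [RightDuals D] {F G : C ⥤ᵖ D} (τ : F ⟶ G)
    {r s : C} {X : r ⟶ s} {Y : s ⟶ r} (a : X ⊣ Y) :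
    (dualNaturality τ X).hom = (conjugateEquiv ((adj (τ.app r)).comp (F.mapAdjunction a))
      ((G.mapAdjunction a).comp (adj (τ.app s)))).symm (τ.naturality Y).hom := by
  rw [dualNaturality_hom, ← iterated_mateEquiv_conjugateEquiv_symm, mate_naturality]

/-- The component of `τ**` at `X` is a double transpose of the component of `τ` at `X`, for any `Y`
that is both a left and a right dual of `X`. -/
theorem dualNaturality_dualTrans_hom [LeftDuals C] [RightDuals D] {F G : C ⥤ᵖ D} (τ : F ⟶ G)
    {r s : C} {X : r ⟶ s} {Y : s ⟶ r} (a : X ⊣ Y) (a' : Y ⊣ X) :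
    (dualNaturality (dualTrans τ) X).hom =
      doubleMate ((adj (τ.app s)).comp (F.mapAdjunction a'))
        ((F.mapAdjunction a).comp (adj (dual (τ.app s))))
        ((G.mapAdjunction a').comp (adj (τ.app r)))
        ((adj (dual (τ.app r))).comp (G.mapAdjunction a)) (τ.naturality X).hom := by
  rw [dualNaturality_hom_eq_conjugate _ a, doubleMate, ← dualNaturality_hom_eq_conjugate τ a']
  rfl

variable [RightDuals C] [PivotalStructure C] [RightDuals D] [PivotalStructure D]

/-- The modification axiom for the components `ι_{τ_r}`. -/
theorem dualNaturality_dualTrans_comp_ι {F G : C ⥤ᵖ D} (hF : IsPivotal F) (hG : IsPivotal G)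
    (τ : F ⟶ G) {r s : C} (X : r ⟶ s) :
    (dualNaturality (dualTrans τ) X).hom ≫ (ι (τ.app r)).hom ▷ G.map X =
      F.map X ◁ (ι (τ.app s)).hom ≫ (τ.naturality X).hom := by
  have h := doubleMate_pivot ((adj (τ.app s)).comp (F.mapAdjunction (adj X)))
    ((F.mapAdjunction (leftAdj X)).comp (adj (dual (τ.app s))))
    ((G.mapAdjunction (adj X)).comp (adj (τ.app r)))
    ((adj (dual (τ.app r))).comp (G.mapAdjunction (leftAdj X))) (τ.naturality X).hom
  rw [pivot_comp, pivot_comp, pivot_adj, pivot_adj, hF.pivot_map, hG.pivot_map, whiskerLeft_id,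
    id_whiskerRight, Category.comp_id, Category.id_comp] at h
  rw [dualNaturality_dualTrans_hom τ (leftAdj X) (adj X)]
  exact h

/-- The invertible modification `τ** ≅ τ` with components `ι_{τ_r}`. -/
def pivotModification {F G : C ⥤ᵖ D} (hF : IsPivotal F) (hG : IsPivotal G) (τ : F ⟶ G) :
    dualTrans (dualTrans τ) ≅ τ :=
  Pseudofunctor.StrongTrans.isoMk (fun r => ι (τ.app r))
    (fun {_ _} X => (dualNaturality_dualTrans_comp_ι hF hG τ X).symm)

end DoubleDual

/-! ### Evaluation at an object -/

section Adjunction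
variable {C : Type u} [Bicategory.{w, v} C]

theorem adjunction_ext {r s : C} {X : r ⟶ s} {Y : s ⟶ r} {a b : X ⊣ Y} (h : a.unit = b.unit)
    (h' : a.counit = b.counit) : a = b := by
  cases a; cases b; cases h; cases h'; rfl

/-- The unit of a composite adjunction without the implicit coherence isomorphisms, so that both
sides are preserved definitionally by evaluation at an object. -/
theorem comp_unit_eq {r s t : C} {X₁ : r ⟶ s} {Y₁ : s ⟶ r} {X₂ : s ⟶ t} {Y₂ : t ⟶ s}
    (a : X₁ ⊣ Y₁) (b : X₂ ⊣ Y₂) :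
    (a.comp b).unit = a.unit ≫ X₁ ◁ ((λ_ _).inv ≫ b.unit ▷ Y₁ ≫ (α_ _ _ _).hom) ≫
      (α_ _ _ _).inv := by
  dsimp [Adjunction.comp]; bicategory

/-- The counit of a composite adjunction without the implicit coherence isomorphisms. -/
theorem comp_counit_eq {r s t : C} {X₁ : r ⟶ s} {Y₁ : s ⟶ r} {X₂ : s ⟶ t} {Y₂ : t ⟶ s}
    (a : X₁ ⊣ Y₁) (b : X₂ ⊣ Y₂) :
    (a.comp b).counit = (α_ _ _ _).hom ≫ Y₂ ◁ ((α_ _ _ _).inv ≫ a.counit ▷ X₂ ≫ (λ_ _).hom) ≫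
      b.counit := by
  dsimp [Adjunction.comp]; bicategory

end Adjunction

section Eval
variable {C : Type u₁} [Bicategory.{w₁, v₁} C] {D : Type u₂} [Bicategory.{w₂, v₂} D]
variable [RightDuals C] [PivotalStructure C] [RightDuals D] [PivotalStructure D]

/-- The component at `r` of an adjunction between transformations of pivotal pseudofunctors. -/
@[simps]
def evalAdj {F G : PivotalFun C D} {σ : F ⟶ G} {τ : G ⟶ F} (a : σ ⊣ τ) (r : C) :
    σ.hom.app r ⊣ τ.hom.app r where
  unit := a.unit.hom.as.app r
  counit := a.counit.hom.as.app r
  left_triangle := by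
    have h := congrArg (fun m => m.hom.as.app r) ((leftZigzag_eq _ _).symm.trans a.left_triangle)
    exact (leftZigzag_eq _ _).trans h
  right_triangle := by
    have h := congrArg (fun m => m.hom.as.app r) ((rightZigzag_eq _ _).symm.trans a.right_triangle)
    exact (rightZigzag_eq _ _).trans h

theorem evalAdj_comp {F G H : PivotalFun C D} {σ : F ⟶ G} {τ : G ⟶ F} {σ' : G ⟶ H} {τ' : H ⟶ G}
    (a : σ ⊣ τ) (b : σ' ⊣ τ') (r : C) :
    evalAdj (a.comp b) r = (evalAdj a r).comp (evalAdj b r) := by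
  apply adjunction_ext
  · rw [evalAdj_unit, comp_unit_eq, comp_unit_eq]; rfl
  · rw [evalAdj_counit, comp_counit_eq, comp_counit_eq]; rfl

theorem conjugateEquiv_symm_evalAdj {F G : PivotalFun C D} {σ σ' : F ⟶ G} {τ τ' : G ⟶ F}
    (a : σ ⊣ τ) (b : σ' ⊣ τ') (f : τ ⟶ τ') (r : C) :
    ((conjugateEquiv a b).symm f).hom.as.app r =
      (conjugateEquiv (evalAdj a r) (evalAdj b r)).symm (f.hom.as.app r) := by
  rw [conjugateEquiv_symm_apply', conjugateEquiv_symm_apply']; rfl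

theorem doubleMate_evalAdj {F G : PivotalFun C D} {σ σ₂ τ τ₂ : F ⟶ G} {σ₁ τ₁ : G ⟶ F}
    (a : σ₁ ⊣ σ) (a' : σ₂ ⊣ σ₁) (b : τ₁ ⊣ τ) (b' : τ₂ ⊣ τ₁) (f : σ ⟶ τ) (r : C) :
    (doubleMate a a' b b' f).hom.as.app r =
      doubleMate (evalAdj a r) (evalAdj a' r) (evalAdj b r) (evalAdj b' r) (f.hom.as.app r) := by
  rw [doubleMate, conjugateEquiv_symm_evalAdj, conjugateEquiv_symm_evalAdj, doubleMate]

/-- Evaluation at `r` sends the chosen and the identity adjunctions definitionally to the chosen and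
the identity adjunctions of the target, so this is an instance of `doubleMate_evalAdj`. -/
theorem doubleDual_mapId_app (F : PivotalFun C D) (r : C) :
    ((doubleDual (PivotalFun C D)).mapId F).hom.hom.as.app r =
      ((doubleDual D).mapId (F.1.obj r)).hom :=
  doubleMate_evalAdj (adj (𝟙 F)) (adj (dual (𝟙 F))) (Adjunction.id F) (Adjunction.id F)
    (𝟙 (𝟙 F)) r

theorem doubleDual_mapComp_app {F G H : PivotalFun C D} (σ : F ⟶ G) (τ : G ⟶ H) (r : C) :
    ((doubleDual (PivotalFun C D)).mapComp σ τ).hom.hom.as.app r =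
      ((doubleDual D).mapComp (σ.hom.app r) (τ.hom.app r)).hom := by
  have h := doubleMate_evalAdj (adj (σ ≫ τ)) (adj (dual (σ ≫ τ))) ((adj τ).comp (adj σ))
    ((adj (dual σ)).comp (adj (dual τ))) (𝟙 (σ ≫ τ)) r
  rw [evalAdj_comp, evalAdj_comp] at h
  exact h

/-- The pivotal structure of the bicategory of pivotal pseudofunctors, with components those of the
pivotal structure of the target. -/
@[reducible]
def pivotalStructurePivotalFun : PivotalStructure (PivotalFun C D) where
  ι {F G} τ := InducedBicategory.isoMk (pivotModification F.2 G.2 τ.hom)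
  ι_naturality {F G σ τ} f := by
    ext r
    change (transpose (transpose f)).hom.as.app r ≫ (ι (τ.hom.app r)).hom =
      (ι (σ.hom.app r)).hom ≫ f.hom.as.app r
    rw [transpose_transpose, doubleMate_evalAdj]
    exact ι_naturality _
  ι_id F := by
    ext r
    exact (ι_id (F.1.obj r)).trans (doubleDual_mapId_app F r).symm
  ι_comp {F G H} σ τ := by
    ext r
    exact (ι_comp (σ.hom.app r) (τ.hom.app r)).trans
      (congrArg (· ≫ (ι (σ.hom.app r)).hom ▷ dual (dual (τ.hom.app r)) ≫
        σ.hom.app r ◁ (ι (τ.hom.app r)).hom) (doubleDual_mapComp_app σ τ r).symm)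

end Eval

end CategoryTheory.Bicategory

theorem mainTheorem3 {C : Type u₁} [Bicategory.{w₁, v₁} C] {D : Type u₂} [Bicategory.{w₂, v₂} D]
    [Bicategory.RightDuals C] [Bicategory.PivotalStructure C]
    [Bicategory.RightDuals D] [Bicategory.PivotalStructure D] :
    ∃ P : Bicategory.PivotalStructure (Bicategory.PivotalFun C D),
      ∀ {F G : Bicategory.PivotalFun C D} (τ : F ⟶ G) (r : C),
        (P.ι τ).hom.hom.as.app r = (Bicategory.PivotalStructure.ι (τ.hom.app r)).hom :=
  ⟨Bicategory.pivotalStructurePivotalFun, fun _ _ => rfl⟩
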